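/- Let $K$ be a field and let $A$ be a finite-dimensional (left) Leibniz algebra over $K$, that is, a finite-dimensional vector space with a bilinear product satisfying $x(yz)=(xy)z+y(xz)$ for all $x,y,z\in A$. For an algebra $B$, let $F(B)$ be the intersection of all maximal subalgebras of $B$ (with $F(B)=B$ if there are none), and let the Frattini ideal $\Phi(B)$ be the largest two-sided ideal of $B$ contained in $F(B)$. Let $A^2=AA$ be the subalgebra of $A$ spanned by all products $xy$ with $x,y\in A$. An algebra $B$ is nilpotent if $B^{c+1}=0$ for some $c\ge 0$, where $B^1=B$ and $B^{n+1}=BB^{n}$ is the span of all products $xy$ with $x\in B$, $y\in B^n$. If $\Phi(A)=0$ and $A^2$ is nilpotent, then $A$ is elementary, that is, $\Phi(M)=0$ for every subalgebra $M$ of $A$. -/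

import Mathlib

namespace LeibnizFrattini

/-- `A` satisfies the (left) Leibniz identity `x(yz) = (xy)z + y(xz)`. Together with the bilinear
product of a non-unital, non-associative `K`-algebra this makes `A` a Leibniz algebra. -/
class IsLeibniz (A : Type*) [NonUnitalNonAssocRing A] : Prop where
  leibniz : ∀ x y z : A, x * (y * z) = (x * y) * z + y * (x * z)

section

variable (K : Type*) (A : Type*) [Field K] [NonUnitalNonAssocRing A] [Module K A]

/-- The Frattini subalgebra `F(A)`: the intersection of all maximal (proper) subalgebras of `A`
(and `A` itself if there are none). -/
def frattiniSubalgebra [IsScalarTower K A A] [SMulCommClass K A A] : NonUnitalSubalgebra K A :=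
  sInf {M : NonUnitalSubalgebra K A | IsCoatom M}

variable {K A} in
/-- A subspace `I` of `A` is a (two-sided) ideal. -/
def IsTwoSidedIdeal (I : Submodule K A) : Prop :=
  ∀ a : A, ∀ x ∈ I, a * x ∈ I ∧ x * a ∈ I

/-- The Frattini ideal `Φ(A)`: the largest ideal of `A` contained in `F(A)`, that is, the sum of
all ideals of `A` contained in `F(A)`. -/
def frattiniIdeal [IsScalarTower K A A] [SMulCommClass K A A] : Submodule K A :=
  sSup {I : Submodule K A | IsTwoSidedIdeal I ∧ I ≤ (frattiniSubalgebra K A).toSubmodule}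

/-- `Φ(A)` really is the largest ideal contained in `F(A)`. -/
theorem isGreatest_frattiniIdeal [IsScalarTower K A A] [SMulCommClass K A A] :
    IsGreatest {I : Submodule K A | IsTwoSidedIdeal I ∧
      I ≤ (frattiniSubalgebra K A).toSubmodule} (frattiniIdeal K A) := by
  refine ⟨⟨?_, sSup_le fun I hI => hI.2⟩, fun I hI => le_sSup hI⟩
  intro a x hx
  have hl : frattiniIdeal K A ≤ (frattiniIdeal K A).comap (LinearMap.mulLeft K a) :=
    sSup_le fun I hI y hy =>
      Submodule.mem_comap.2 ((le_sSup hI : I ≤ frattiniIdeal K A) (hI.1 a y hy).1)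
  have hr : frattiniIdeal K A ≤ (frattiniIdeal K A).comap (LinearMap.mulRight K a) :=
    sSup_le fun I hI y hy =>
      Submodule.mem_comap.2 ((le_sSup hI : I ≤ frattiniIdeal K A) (hI.1 a y hy).2)
  exact ⟨hl hx, hr hx⟩

/-- `A` is elementary: the Frattini ideal of every subalgebra `M` of `A`, formed in the algebra
`M`, is zero. -/
def IsElementary [IsScalarTower K A A] [SMulCommClass K A A] : Prop :=
  ∀ M : NonUnitalSubalgebra K A, frattiniIdeal K M = ⊥

/-- The subalgebra `A² = AA`, spanned by all products `xy` with `x, y ∈ A`. -/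
def square : NonUnitalSubalgebra K A where
  __ := Submodule.span K {z : A | ∃ x y : A, x * y = z}
  mul_mem' {x y} _ _ := Submodule.subset_span ⟨x, y, rfl⟩

/-- The left normed powers: `leftPower K A n` is `A^(n+1)`, where `A^1 = A` and
`A^(n+1) = A A^n` is the span of all products `xy` with `x ∈ A`, `y ∈ A^n`. -/
def leftPower : ℕ → Submodule K A
  | 0 => ⊤
  | n + 1 => Submodule.span K {z : A | ∃ x : A, ∃ y ∈ leftPower n, x * y = z}

/-- `A` is nilpotent: `A^(c+1) = 0` for some `c`. -/
def IsNilpotentAlgebra : Prop :=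
  ∃ c : ℕ, leftPower K A c = ⊥

end

end LeibnizFrattini

/-!
Let `N = A²`. The square of a nilpotent ideal lies in every maximal subalgebra, so `Φ(A) = 0` forces
`N² = 0` (`mul_eq_zero_of_nilpotent`). Moreover `Φ(A) = 0` provides every abelian ideal with a
complementary subalgebra (`exists_isCompl_of_abelian`). In particular `A = N ⊕ C` with `C² = 0`,
and `N` is a completely reducible `A`-bimodule (`exists_ideal_isCompl`).

The left and right multiplications of `A` on `N` commute with each other. For the left ones this
is the Leibniz identity; for the right ones complete reducibility is used to split off the part of
`N` annihilated from the right, outside of which `n * a = -(a * n)`. By complete reducibility the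
commutative algebra that these operators generate is reduced, and hence so is the algebra generated
by the multiplications by elements of a subalgebra `M`. A reduced commutative Artinian ring is
semisimple, so `N` is completely reducible over `M` as well (`exists_stable_compl`).

Suppose that `Φ(M) ≠ 0`. Since `Φ(M) ≤ M² ≤ N`, there are a minimal nonzero `M`-stable subspace `J`
of `Φ(M)` and an `M`-stable complement `P` of `J` in `N`. If left multiplication by some `m ∈ M` is
injective on `J`, then `{x ∈ M | m * x ∈ P}` is a subalgebra that complements `J` in `M`, which is
impossible for a set of non-generators `J` (`exists_mul_eq_zero_of_le_frattiniIdeal`). Otherwise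
`J` is annihilated by `M` on both sides (`annihilated_of_not_injective`). Then
`M² ≤ N * M + M * N ≤ P` because `C² = 0`, so that `J ≤ Φ(M) ≤ M²` is contained in `P`, a
contradiction (`isElementary_of_split`).
-/

namespace LeibnizFrattini

/-! ### Semisimple families of commuting endomorphisms -/

section Endomorphisms

variable {K V : Type*} [Field K] [AddCommGroup V] [Module K V]

/-- Complete reducibility of a commuting family of endomorphisms passes to subfamilies: the
commutative algebra generated by the large family is reduced, hence so is the algebra generated by
the small one, which is therefore a semisimple ring. -/
theorem exists_invariant_isCompl_of_subset [FiniteDimensional K V] {s t : Set (Module.End K V)}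
    (hcomm : ∀ f ∈ s, ∀ g ∈ s, f * g = g * f)
    (hs : ∀ W : Submodule K V, (∀ f ∈ s, ∀ v ∈ W, f v ∈ W) →
      ∃ W' : Submodule K V, (∀ f ∈ s, ∀ v ∈ W', f v ∈ W') ∧ IsCompl W W')
    (hts : t ⊆ s) (W : Submodule K V) (hW : ∀ f ∈ t, ∀ v ∈ W, f v ∈ W) :
    ∃ W' : Submodule K V, (∀ f ∈ t, ∀ v ∈ W', f v ∈ W') ∧ IsCompl W W' := by
  have hadj : ∀ (u : Set (Module.End K V)) (W : Submodule K V), (∀ f ∈ u, ∀ v ∈ W, f v ∈ W) →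
      ∀ f ∈ Algebra.adjoin K u, ∀ v ∈ W, f v ∈ W := by
    intro u W h f hf
    induction hf using Algebra.adjoin_induction with
    | mem f hf => exact h f hf
    | algebraMap r => exact fun v hv => W.smul_mem r hv
    | add f g _ _ hf hg => exact fun v hv => W.add_mem (hf v hv) (hg v hv)
    | mul f g _ _ hf hg => exact fun v hv => hf _ (hg v hv)
  have hcomm' : ∀ f ∈ Algebra.adjoin K s, ∀ g ∈ s, f * g = g * f := by
    intro f hf g hg
    induction hf using Algebra.adjoin_induction with
    | mem f hf => exact hcomm f hf g hg
    | algebraMap r => exact Algebra.commutes r g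
    | add f f' _ _ h h' => rw [add_mul, mul_add, h, h']
    | mul f f' _ _ h h' => rw [mul_assoc, h', ← mul_assoc, h, mul_assoc]
  -- A complement of `ker f` that is invariant under `f` is mapped by `f` into `ker f` when
  -- `f * f = 0`, so it is zero.
  have hred : ∀ f ∈ Algebra.adjoin K s, f * f = 0 → f = 0 := by
    intro f hf hff
    obtain ⟨P, hP, hc⟩ := hs (LinearMap.ker f) (by
      intro g hg v hv
      rw [LinearMap.mem_ker] at hv ⊢
      rw [← Module.End.mul_apply, hcomm' f hf g hg, Module.End.mul_apply, hv, map_zero])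
    have hPf : P ≤ LinearMap.ker f := by
      intro v hv
      have h1 : f v ∈ P := hadj s P hP f hf v hv
      have h2 : f v ∈ LinearMap.ker f := by
        rw [LinearMap.mem_ker, ← Module.End.mul_apply, hff, LinearMap.zero_apply]
      exact LinearMap.mem_ker.2 (Submodule.disjoint_def.1 hc.disjoint _ h2 h1)
    have : LinearMap.ker f = ⊤ := by rw [← hc.sup_eq_top, sup_eq_left.2 hPf]
    exact LinearMap.ker_eq_top.1 this
  have hmul := Algebra.isMulCommutative_adjoin K
    (fun f hf g hg => hcomm f (hts hf) g (hts hg) : ∀ f ∈ t, ∀ g ∈ t, f * g = g * f)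
  let _ : CommRing (Algebra.adjoin K t) :=
    { (Algebra.adjoin K t).toRing with mul_comm := hmul.is_comm.comm }
  have : IsReduced (Algebra.adjoin K t) := by
    rw [isReduced_iff_pow_one_lt 2 one_lt_two]
    intro f hf
    refine Subtype.ext (hred f (Algebra.adjoin_mono hts f.2) ?_)
    rw [← sq]
    exact congrArg Subtype.val hf
  have : IsArtinianRing (Algebra.adjoin K t) := IsArtinianRing.of_finite K _
  have : IsSemisimpleRing (Algebra.adjoin K t) :=
    IsArtinianRing.isSemisimpleRing_of_isReduced (Algebra.adjoin K t)
  let W₁ : Submodule (Algebra.adjoin K t) V :=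
    { W with smul_mem' := fun f v hv => hadj t W hW f f.2 v hv }
  obtain ⟨W₂, h₂⟩ := exists_isCompl W₁
  refine ⟨W₂.restrictScalars K, fun f hf v hv =>
    W₂.smul_mem (⟨f, Algebra.subset_adjoin hf⟩ : Algebra.adjoin K t) hv, ?_⟩
  constructor
  · rw [Submodule.disjoint_def]
    exact fun v hv hv' => (Submodule.disjoint_def (p := W₁)).1 h₂.disjoint v hv hv'
  · rw [codisjoint_iff, eq_top_iff]
    intro v _
    have hv : v ∈ W₁ ⊔ W₂ := h₂.sup_eq_top ▸ Submodule.mem_top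
    obtain ⟨a, ha, b, hb, rfl⟩ := Submodule.mem_sup.1 hv
    exact Submodule.add_mem_sup ha hb

end Endomorphisms

variable {K A : Type*} [Field K] [NonUnitalNonAssocRing A] [Module K A]

/-! ### Sums of subalgebras and ideals -/

section NonGenerators

/-- The subalgebra `D + I`, for a subalgebra `D` and an ideal `I`. -/
def supIdeal (D : NonUnitalSubalgebra K A) {I : Submodule K A} (hI : IsTwoSidedIdeal I) :
    NonUnitalSubalgebra K A where
  __ := D.toSubmodule ⊔ I
  mul_mem' {x y} hx hy := by
    obtain ⟨d, hd, i, hi, rfl⟩ := Submodule.mem_sup.1 hx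
    obtain ⟨e, he, j, hj, rfl⟩ := Submodule.mem_sup.1 hy
    have : (d + i) * (e + j) = d * e + (d * j + i * (e + j)) := by
      rw [add_mul, mul_add d, add_assoc]
    rw [this]
    exact Submodule.add_mem_sup (D.mul_mem hd he) (I.add_mem (hI d j hj).1 (hI (e + j) i hi).2)

theorem wellFoundedGT_nonUnitalSubalgebra [FiniteDimensional K A] :
    WellFoundedGT (NonUnitalSubalgebra K A) :=
  StrictMono.wellFoundedGT (f := fun S : NonUnitalSubalgebra K A => S.toSubmodule)
    (Monotone.strictMono_of_injective (fun _ _ h => h)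
      NonUnitalSubalgebra.toSubmodule_injective)

theorem wellFoundedLT_nonUnitalSubalgebra [FiniteDimensional K A] :
    WellFoundedLT (NonUnitalSubalgebra K A) :=
  StrictMono.wellFoundedLT (f := fun S : NonUnitalSubalgebra K A => S.toSubmodule)
    (Monotone.strictMono_of_injective (fun _ _ h => h)
      NonUnitalSubalgebra.toSubmodule_injective)

variable [IsScalarTower K A A] [SMulCommClass K A A]

theorem sup_eq_top_of_isCoatom {D : NonUnitalSubalgebra K A} (hD : IsCoatom D)
    {I : Submodule K A} (hI : IsTwoSidedIdeal I) (hID : ¬ I ≤ D.toSubmodule) :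
    D.toSubmodule ⊔ I = ⊤ := by
  have hlt : D < supIdeal D hI := by
    refine lt_of_le_of_ne (fun x hx => Submodule.mem_sup_left hx) fun h => hID fun x hx => ?_
    have : x ∈ supIdeal D hI := Submodule.mem_sup_right hx
    rwa [← h] at this
  have h := hD.2 _ hlt
  rw [eq_top_iff]
  intro x _
  have : x ∈ supIdeal D hI := h ▸ NonUnitalAlgebra.mem_top
  exact this

/-- The Frattini ideal consists of non-generators. -/
theorem eq_top_of_sup_frattiniIdeal [FiniteDimensional K A] {D : NonUnitalSubalgebra K A}
    (h : D.toSubmodule ⊔ frattiniIdeal K A = ⊤) : D = ⊤ := by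
  by_contra hD
  have := wellFoundedGT_nonUnitalSubalgebra (K := K) (A := A)
  obtain ⟨M, hM, hDM⟩ := (eq_top_or_exists_le_coatom D).resolve_left hD
  have hΦ : frattiniIdeal K A ≤ M.toSubmodule := fun x hx =>
    NonUnitalAlgebra.mem_sInf.1 ((isGreatest_frattiniIdeal K A).1.2 hx) M hM
  have hle : D.toSubmodule ⊔ frattiniIdeal K A ≤ M.toSubmodule := sup_le hDM hΦ
  rw [h, top_le_iff, NonUnitalAlgebra.toSubmodule_eq_top] at hle
  exact hM.1 hle

/-- `eq_top_of_sup_frattiniIdeal` for the Frattini ideal of a subalgebra `M`, in terms of the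
ambient algebra. -/
theorem le_of_le_sup_map_frattiniIdeal [FiniteDimensional K A] {M D : NonUnitalSubalgebra K A}
    (hDM : D ≤ M)
    (h : M.toSubmodule ≤
      D.toSubmodule ⊔ (frattiniIdeal K M).map M.toSubmodule.subtype) : M ≤ D := by
  have : FiniteDimensional K M := inferInstanceAs (FiniteDimensional K M.toSubmodule)
  let D' : NonUnitalSubalgebra K M :=
    { D.toSubmodule.comap M.toSubmodule.subtype with
      mul_mem' := fun {x y} hx hy => D.mul_mem hx hy }
  have hD' : D' = ⊤ := by
    apply eq_top_of_sup_frattiniIdeal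
    rw [eq_top_iff]
    rintro ⟨x, hx⟩ _
    obtain ⟨d, hd, _, ⟨z, hz, rfl⟩, hdz⟩ := Submodule.mem_sup.1 (h hx)
    refine Submodule.mem_sup.2 ⟨⟨d, hDM hd⟩, hd, z, hz, Subtype.ext hdz⟩
  intro x hx
  have : (⟨x, hx⟩ : M) ∈ D' := hD' ▸ NonUnitalAlgebra.mem_top
  exact this

theorem eq_bot_of_le_frattiniSubalgebra (hΦ : frattiniIdeal K A = ⊥) {I : Submodule K A}
    (hI : IsTwoSidedIdeal I) (hIF : I ≤ (frattiniSubalgebra K A).toSubmodule) : I = ⊥ :=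
  le_bot_iff.1 (hΦ ▸ le_sSup ⟨hI, hIF⟩)

/-- In an algebra with zero Frattini ideal, every abelian ideal is complemented by a
subalgebra. A minimal subalgebra `C` with `B + C = A` meets `B` in an ideal, which has to be zero
since otherwise a maximal subalgebra avoiding it would allow `C` to be replaced by a smaller one. -/
theorem exists_isCompl_of_abelian [FiniteDimensional K A] (hΦ : frattiniIdeal K A = ⊥)
    {B : Submodule K A} (hB : IsTwoSidedIdeal B) (hBB : ∀ x ∈ B, ∀ y ∈ B, x * y = 0) :
    ∃ C : NonUnitalSubalgebra K A, IsCompl B C.toSubmodule := by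
  have := wellFoundedLT_nonUnitalSubalgebra (K := K) (A := A)
  obtain ⟨C, hC, hmin⟩ := WellFounded.has_min
    (wellFounded_lt : WellFounded ((· < ·) : NonUnitalSubalgebra K A → _ → Prop))
    {C | B ⊔ C.toSubmodule = ⊤} ⟨⊤, by simp⟩
  have hC' : B ⊔ C.toSubmodule = ⊤ := hC
  have hI : IsTwoSidedIdeal (B ⊓ C.toSubmodule) := by
    intro a x hx
    obtain ⟨b, hb, c, hc, rfl⟩ := Submodule.mem_sup.1 (hC' ▸ Submodule.mem_top : a ∈ _)
    rw [add_mul, mul_add, hBB b hb x hx.1, hBB x hx.1 b hb, zero_add, zero_add]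
    exact ⟨⟨(hB c x hx.1).1, C.mul_mem hc hx.2⟩, ⟨(hB c x hx.1).2, C.mul_mem hx.2 hc⟩⟩
  refine ⟨C, disjoint_iff.2 (eq_bot_of_le_frattiniSubalgebra hΦ hI ?_), codisjoint_iff.2 hC⟩
  intro x hx
  refine NonUnitalAlgebra.mem_sInf.2 fun M hM => ?_
  by_contra hxM
  have htop := sup_eq_top_of_isCoatom hM hI (fun h => hxM (h hx))
  refine hmin (M ⊓ C) ?_ (lt_of_le_of_ne inf_le_right fun h => hxM ?_)
  · rw [Set.mem_ofPred_eq, eq_top_iff, ← hC']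
    refine sup_le le_sup_left fun c hc => ?_
    obtain ⟨m, hm, i, hi, rfl⟩ := Submodule.mem_sup.1 (htop ▸ Submodule.mem_top : c ∈ _)
    refine add_comm m i ▸ Submodule.add_mem_sup hi.1 ⟨hm, ?_⟩
    simpa using C.toSubmodule.sub_mem hc hi.2
  · exact (h.ge hx.2).1

end NonGenerators

/-! ### Powers of an ideal -/

section Powers

/-- The left normed powers of a subspace `N`, indexed so that `idealPower N n` is `N^(n+1)`. -/
def idealPower (N : Submodule K A) : ℕ → Submodule K A
  | 0 => N
  | n + 1 => Submodule.span K {z : A | ∃ x ∈ N, ∃ y ∈ idealPower N n, x * y = z}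

theorem mul_mem_idealPower_succ {N : Submodule K A} {n : ℕ} {x y : A} (hx : x ∈ N)
    (hy : y ∈ idealPower N n) : x * y ∈ idealPower N (n + 1) :=
  Submodule.subset_span ⟨x, hx, y, hy, rfl⟩

theorem idealPower_succ_le {N : Submodule K A} {n : ℕ} {Q : Submodule K A}
    (h : ∀ x ∈ N, ∀ y ∈ idealPower N n, x * y ∈ Q) : idealPower N (n + 1) ≤ Q := by
  refine Submodule.span_le.2 ?_
  rintro _ ⟨x, hx, y, hy, rfl⟩
  exact h x hx y hy

theorem idealPower_le (N : NonUnitalSubalgebra K A) (n : ℕ) :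
    idealPower N.toSubmodule n ≤ N.toSubmodule := by
  induction n with
  | zero => exact le_rfl
  | succ n ih => exact idealPower_succ_le fun x hx y hy => N.mul_mem hx (ih hy)

theorem mul_mul_eq_sub [IsLeibniz A] (x y z : A) : (x * y) * z = x * (y * z) - y * (x * z) := by
  rw [IsLeibniz.leibniz x y z, add_sub_cancel_right]

theorem idealPower_eq_map_leftPower (N : NonUnitalSubalgebra K A) (n : ℕ) :
    idealPower N.toSubmodule n = (leftPower K N n).map N.toSubmodule.subtype := by
  induction n with
  | zero => simp [idealPower, leftPower]
  | succ n ih =>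
    apply le_antisymm
    · refine idealPower_succ_le fun x hx y hy => ?_
      rw [ih] at hy
      obtain ⟨z, hz, rfl⟩ := hy
      exact ⟨(⟨x, hx⟩ : N) * z, Submodule.subset_span ⟨⟨x, hx⟩, z, hz, rfl⟩, rfl⟩
    · rw [leftPower, Submodule.map_span_le]
      rintro _ ⟨x, y, hy, rfl⟩
      exact mul_mem_idealPower_succ x.2 (ih ▸ Submodule.mem_map_of_mem hy)

variable [IsScalarTower K A A]

theorem idealPower_mul_mem [IsLeibniz A] {N : Submodule K A} (i : ℕ) :
    ∀ (j : ℕ), ∀ x ∈ idealPower N i, ∀ y ∈ idealPower N j, x * y ∈ idealPower N (i + j + 1) := by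
  induction i with
  | zero =>
    intro j x hx y hy
    rw [zero_add]
    exact mul_mem_idealPower_succ hx hy
  | succ i ih =>
    intro j x hx z hz
    suffices idealPower N (i + 1) ≤
        (idealPower N (i + 1 + j + 1)).comap (LinearMap.mulRight K z) from this hx
    refine idealPower_succ_le fun x hx y hy => ?_
    rw [Submodule.mem_comap, LinearMap.mulRight_apply, mul_mul_eq_sub,
      show i + 1 + j + 1 = i + j + 1 + 1 by ring]
    refine Submodule.sub_mem _ (mul_mem_idealPower_succ hx (ih j y hy z hz)) ?_
    exact ih (j + 1) y hy _ (mul_mem_idealPower_succ hx hz)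

/-- A subalgebra `D` with `N ≤ D + N²` contains the nilpotent ideal `N`: inductively
`N ≤ D + N^k` for all `k`. -/
theorem le_of_le_sup_idealPower_one [IsLeibniz A] {N D : NonUnitalSubalgebra K A}
    (h : N.toSubmodule ≤ D.toSubmodule ⊔ idealPower N.toSubmodule 1)
    (hnil : ∃ c, idealPower N.toSubmodule c = ⊥) : N ≤ D := by
  have key : ∀ k, N.toSubmodule ≤ D.toSubmodule ⊔ idealPower N.toSubmodule k := by
    intro k
    induction k with
    | zero => exact le_sup_right
    | succ k ih =>
      refine h.trans (sup_le le_sup_left (idealPower_succ_le fun x hx y hy => ?_))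
      obtain ⟨s, hs, p, hp, rfl⟩ := Submodule.mem_sup.1 (ih hx)
      obtain ⟨t, ht, q, hq, rfl⟩ := Submodule.mem_sup.1 (ih hy)
      have hsN : s ∈ N.toSubmodule := by
        simpa using N.toSubmodule.sub_mem hx (idealPower_le N k hp)
      have : (s + p) * (t + q) = s * t + (s * q + p * (t + q)) := by
        rw [add_mul, mul_add s, add_assoc]
      rw [this]
      exact Submodule.add_mem_sup (D.mul_mem hs ht) (Submodule.add_mem _
        (mul_mem_idealPower_succ hsN hq) (idealPower_mul_mem k 0 p hp _ hy))
  obtain ⟨c, hc⟩ := hnil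
  have := key c
  rwa [hc, sup_bot_eq] at this

variable [SMulCommClass K A A] [IsLeibniz A]

theorem isTwoSidedIdeal_idealPower {N : Submodule K A} (hN : IsTwoSidedIdeal N) (n : ℕ) :
    IsTwoSidedIdeal (idealPower N n) := by
  induction n with
  | zero => exact hN
  | succ n ih =>
    intro a x hx
    constructor
    · suffices idealPower N (n + 1) ≤
          (idealPower N (n + 1)).comap (LinearMap.mulLeft K a) from this hx
      refine idealPower_succ_le fun x hx y hy => ?_
      rw [Submodule.mem_comap, LinearMap.mulLeft_apply, IsLeibniz.leibniz]
      exact Submodule.add_mem _ (mul_mem_idealPower_succ (hN a x hx).1 hy)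
        (mul_mem_idealPower_succ hx (ih a y hy).1)
    · suffices idealPower N (n + 1) ≤
          (idealPower N (n + 1)).comap (LinearMap.mulRight K a) from this hx
      refine idealPower_succ_le fun x hx y hy => ?_
      rw [Submodule.mem_comap, LinearMap.mulRight_apply, mul_mul_eq_sub]
      exact Submodule.sub_mem _ (mul_mem_idealPower_succ hx (ih a y hy).2)
        (idealPower_mul_mem n 0 y hy _ (hN a x hx).2)

/-- The derived subalgebra of a nilpotent ideal lies in every maximal subalgebra, so a nilpotent
ideal of an algebra with zero Frattini ideal is abelian. -/
theorem mul_eq_zero_of_nilpotent (hΦ : frattiniIdeal K A = ⊥) {N : NonUnitalSubalgebra K A}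
    (hN : IsTwoSidedIdeal N.toSubmodule) (hnil : IsNilpotentAlgebra K N) :
    ∀ x ∈ N, ∀ y ∈ N, x * y = 0 := by
  obtain ⟨c, hc⟩ := hnil
  have hc' : idealPower N.toSubmodule c = ⊥ := by
    rw [idealPower_eq_map_leftPower, hc, Submodule.map_bot]
  have hbot : idealPower N.toSubmodule 1 = ⊥ := by
    refine eq_bot_of_le_frattiniSubalgebra hΦ (isTwoSidedIdeal_idealPower hN 1) fun x hx => ?_
    refine NonUnitalAlgebra.mem_sInf.2 fun M hM => ?_
    by_contra hxM
    have htop := sup_eq_top_of_isCoatom hM (isTwoSidedIdeal_idealPower hN 1) (fun h => hxM (h hx))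
    exact hxM (le_of_le_sup_idealPower_one (htop ▸ le_top) ⟨c, hc'⟩ (idealPower_le N 1 hx))
  intro x hx y hy
  have : x * y ∈ idealPower N.toSubmodule 1 := mul_mem_idealPower_succ hx hy
  rwa [hbot] at this

end Powers

/-! ### The bimodule structure of the derived subalgebra -/

section Bimodule

section Identities

variable [IsLeibniz A] {N : Submodule K A} (hNN : ∀ x ∈ N, ∀ y ∈ N, x * y = 0)
  (hA : ∀ a b : A, a * b ∈ N)

include hNN hA

theorem left_left_comm (a b : A) {n : A} (hn : n ∈ N) : a * (b * n) = b * (a * n) := by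
  rw [IsLeibniz.leibniz, hNN _ (hA a b) n hn, zero_add]

theorem left_right_comm (a b : A) {n : A} (hn : n ∈ N) : a * (n * b) = (a * n) * b := by
  rw [IsLeibniz.leibniz, hNN n hn _ (hA a b), add_zero]

theorem mul_mul_eq_neg (a b : A) {n : A} (hn : n ∈ N) : (n * a) * b = -(a * (n * b)) := by
  rw [mul_mul_eq_sub, hNN n hn _ (hA a b), zero_sub]

/-- The right annihilated part `{n ∈ N | nA = 0}` has an ideal complement in `N`. By the Leibniz
identity right multiplication by `a` equals the negative of left multiplication by `a` on this
complement, hence the right multiplications on `N` commute. -/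
theorem right_right_comm [IsScalarTower K A A]
    (hcompl : ∀ I : Submodule K A, IsTwoSidedIdeal I → I ≤ N →
      ∃ P : Submodule K A, IsTwoSidedIdeal P ∧ P ≤ N ∧ I ⊓ P = ⊥ ∧ I ⊔ P = N)
    (a b : A) {n : A} (hn : n ∈ N) : (n * a) * b = (n * b) * a := by
  let R : Submodule K A := N ⊓ ⨅ d : A, LinearMap.ker (LinearMap.mulRight K d)
  have hR : ∀ x, x ∈ R ↔ x ∈ N ∧ ∀ d, x * d = 0 := fun x => by simp [R]
  obtain ⟨P, hP, hPN, hRP, hsup⟩ := hcompl R (by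
    intro c x hx
    rw [hR] at hx
    rw [hR, hR, hx.2 c]
    refine ⟨⟨hA c x, fun d => ?_⟩, N.zero_mem, fun d => zero_mul d⟩
    rw [← left_right_comm hNN hA c d hx.1, hx.2, mul_zero]) inf_le_left
  have hPneg : ∀ p ∈ P, ∀ c, p * c = -(c * p) := by
    intro p hp c
    have h1 : p * c + c * p ∈ R := by
      refine (hR _).2 ⟨N.add_mem (hA _ _) (hA _ _), fun d => ?_⟩
      rw [add_mul, mul_mul_eq_neg hNN hA c d (hPN hp), ← left_right_comm hNN hA c d (hPN hp),
        neg_add_cancel]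
    have h2 : p * c + c * p ∈ R ⊓ P := ⟨h1, P.add_mem (hP c p hp).2 (hP c p hp).1⟩
    rw [hRP, Submodule.mem_bot] at h2
    exact eq_neg_of_add_eq_zero_left h2
  rw [← hsup] at hn
  obtain ⟨r, hr, p, hp, rfl⟩ := Submodule.mem_sup.1 hn
  have hr' := ((hR r).1 hr).2
  rw [add_mul r, add_mul r, hr', hr', zero_add, zero_add, hPneg _ (hP a p hp).2 b, hPneg p hp a,
    hPneg _ (hP b p hp).2 a, hPneg p hp b, mul_neg, mul_neg,
    left_left_comm hNN hA a b (hPN hp)]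

end Identities

/-- The subspace `I` is stable under left and right multiplication by elements of `S`. -/
def IsStableUnder (S : Set A) (I : Submodule K A) : Prop :=
  ∀ a ∈ S, ∀ x ∈ I, a * x ∈ I ∧ x * a ∈ I

variable [IsScalarTower K A A] [SMulCommClass K A A]

/-- Left multiplication by `a` on the ideal `N`. -/
def leftOp {N : Submodule K A} (hN : IsTwoSidedIdeal N) (a : A) : Module.End K N :=
  (LinearMap.mulLeft K a).restrict fun x hx => (hN a x hx).1

/-- Right multiplication by `a` on the ideal `N`. -/
def rightOp {N : Submodule K A} (hN : IsTwoSidedIdeal N) (a : A) : Module.End K N :=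
  (LinearMap.mulRight K a).restrict fun x hx => (hN a x hx).2

/-- The operators on the ideal `N` given by left and right multiplications by elements of `S`. -/
def multiplications {N : Submodule K A} (hN : IsTwoSidedIdeal N) (S : Set A) :
    Set (Module.End K N) :=
  leftOp hN '' S ∪ rightOp hN '' S

theorem invariant_multiplications_iff {N : Submodule K A} (hN : IsTwoSidedIdeal N) (S : Set A)
    (W : Submodule K N) : (∀ f ∈ multiplications hN S, ∀ v ∈ W, f v ∈ W) ↔
      IsStableUnder S (W.map N.subtype) := by
  constructor
  · rintro h a ha _ ⟨v, hv, rfl⟩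
    exact ⟨⟨_, h _ (Or.inl ⟨a, ha, rfl⟩) v hv, rfl⟩, ⟨_, h _ (Or.inr ⟨a, ha, rfl⟩) v hv, rfl⟩⟩
  · rintro h f (⟨a, ha, rfl⟩ | ⟨a, ha, rfl⟩) v hv
    · obtain ⟨w, hw, e⟩ := (h a ha v ⟨v, hv, rfl⟩).1
      exact (Subtype.ext e : w = leftOp hN a v) ▸ hw
    · obtain ⟨w, hw, e⟩ := (h a ha v ⟨v, hv, rfl⟩).2
      exact (Subtype.ext e : w = rightOp hN a v) ▸ hw

/-- If the Frattini ideal is zero, then an abelian ideal `N` is completely reducible: every ideal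
contained in `N` is complemented in `N` by an ideal. -/
theorem exists_ideal_isCompl [FiniteDimensional K A] (hΦ : frattiniIdeal K A = ⊥)
    {N : Submodule K A} (hN : IsTwoSidedIdeal N) (hNN : ∀ x ∈ N, ∀ y ∈ N, x * y = 0)
    {I : Submodule K A} (hI : IsTwoSidedIdeal I) (hIN : I ≤ N) :
    ∃ P : Submodule K A, IsTwoSidedIdeal P ∧ P ≤ N ∧ I ⊓ P = ⊥ ∧ I ⊔ P = N := by
  obtain ⟨D, hD⟩ := exists_isCompl_of_abelian hΦ hI
    (fun x hx y hy => hNN x (hIN hx) y (hIN hy))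
  refine ⟨N ⊓ D.toSubmodule, ?_, inf_le_left, ?_, ?_⟩
  · intro a x hx
    obtain ⟨b, hb, d, hd, rfl⟩ := Submodule.mem_sup.1 (hD.sup_eq_top ▸ Submodule.mem_top : a ∈ _)
    rw [add_mul, mul_add, hNN b (hIN hb) x hx.1, hNN x hx.1 b (hIN hb), zero_add, zero_add]
    exact ⟨⟨(hN d x hx.1).1, D.mul_mem hd hx.2⟩, ⟨(hN d x hx.1).2, D.mul_mem hx.2 hd⟩⟩
  · rw [inf_comm N, ← inf_assoc, hD.inf_eq_bot, bot_inf_eq]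
  · rw [inf_comm N, ← sup_inf_assoc_of_le _ hIN, hD.sup_eq_top, top_inf_eq]

variable [IsLeibniz A]

/-- Under the hypotheses `Φ(A) = 0`, `A² ≤ N`, `N² = 0`, the ideal `N` is completely reducible not
only under `A` but under every subset of `A`. -/
theorem exists_stable_compl [FiniteDimensional K A] (hΦ : frattiniIdeal K A = ⊥)
    {N : Submodule K A} (hNN : ∀ x ∈ N, ∀ y ∈ N, x * y = 0) (hA : ∀ a b : A, a * b ∈ N)
    (S : Set A) {J : Submodule K A} (hJN : J ≤ N) (hJ : IsStableUnder S J) :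
    ∃ P : Submodule K A, IsStableUnder S P ∧ P ≤ N ∧ J ⊓ P = ⊥ ∧ J ⊔ P = N := by
  have hN : IsTwoSidedIdeal N := fun a x _ => ⟨hA a x, hA x a⟩
  have hcompl : ∀ I : Submodule K A, IsTwoSidedIdeal I → I ≤ N →
      ∃ P : Submodule K A, IsTwoSidedIdeal P ∧ P ≤ N ∧ I ⊓ P = ⊥ ∧ I ⊔ P = N :=
    fun I hI hIN => exists_ideal_isCompl hΦ hN hNN hI hIN
  have hcomm : ∀ f ∈ multiplications hN Set.univ, ∀ g ∈ multiplications hN Set.univ,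
      f * g = g * f := by
    rintro _ (⟨a, -, rfl⟩ | ⟨a, -, rfl⟩) _ (⟨b, -, rfl⟩ | ⟨b, -, rfl⟩) <;> ext ⟨n, hn⟩
    · exact left_left_comm hNN hA a b hn
    · exact left_right_comm hNN hA a b hn
    · exact (left_right_comm hNN hA b a hn).symm
    · exact right_right_comm hNN hA hcompl b a hn
  have hmap : ∀ Q ≤ N, (Q.comap N.subtype).map N.subtype = Q := fun Q hQ => by
    rw [Submodule.map_comap_subtype, inf_eq_right.2 hQ]
  obtain ⟨P, hP, hJP⟩ := exists_invariant_isCompl_of_subset hcomm (by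
    intro W hW
    rw [invariant_multiplications_iff] at hW
    obtain ⟨P, hP, hPN, hinf, hsup⟩ := hcompl (W.map N.subtype)
      (fun a x hx => hW a trivial x hx) (Submodule.map_subtype_le N W)
    refine ⟨P.comap N.subtype, ?_, ?_⟩
    · rw [invariant_multiplications_iff, hmap P hPN]
      exact fun a _ => hP a
    · rw [isCompl_iff, disjoint_iff, codisjoint_iff]
      constructor <;> apply Submodule.map_injective_of_injective N.injective_subtype
      · rw [Submodule.map_inf _ N.injective_subtype, hmap P hPN, hinf, Submodule.map_bot]
      · rw [Submodule.map_sup, hmap P hPN, hsup, Submodule.map_top, Submodule.range_subtype])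
    (Set.union_subset_union (Set.image_mono (Set.subset_univ S))
      (Set.image_mono (Set.subset_univ S)))
    (J.comap N.subtype) ((invariant_multiplications_iff hN S _).2 (by rwa [hmap J hJN]))
  refine ⟨P.map N.subtype, (invariant_multiplications_iff hN S P).1 hP,
    Submodule.map_subtype_le N P, ?_, ?_⟩
  · rw [← hmap J hJN, ← Submodule.map_inf _ N.injective_subtype, hJP.inf_eq_bot,
      Submodule.map_bot]
  · rw [← hmap J hJN, ← Submodule.map_sup, hJP.sup_eq_top, Submodule.map_top,
      Submodule.range_subtype]

end Bimodule

/-! ### The Frattini ideal of a subalgebra -/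

section Subalgebras

variable [IsScalarTower K A A] [SMulCommClass K A A]

/-- The Frattini ideal of `M` lies in every subspace of `M` that contains all products of elements
of `M`: any hyperplane containing these products is a subalgebra, so it cannot miss an element of
the Frattini ideal. -/
theorem map_frattiniIdeal_le [FiniteDimensional K A] (M : NonUnitalSubalgebra K A)
    {Q : Submodule K A} (hQ : ∀ x ∈ M, ∀ y ∈ M, x * y ∈ Q) :
    (frattiniIdeal K M).map M.toSubmodule.subtype ≤ Q := by
  intro x hx
  by_contra hxQ
  obtain ⟨f, hfx, hf⟩ := Submodule.exists_le_ker_of_notMem hxQ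
  have hxM : x ∈ M := Submodule.map_subtype_le M.toSubmodule _ hx
  let D : NonUnitalSubalgebra K A :=
    { M.toSubmodule ⊓ LinearMap.ker f with
      mul_mem' := fun {a b} ha hb => ⟨M.mul_mem ha.1 hb.1, hf (hQ a ha.1 b hb.1)⟩ }
  have hDM : D ≤ M := fun y hy => hy.1
  have := le_of_le_sup_map_frattiniIdeal hDM (by
    intro y hy
    have hdec : y = (y - (f y / f x) • x) + (f y / f x) • x := by abel
    rw [hdec]
    refine Submodule.add_mem_sup ⟨M.toSubmodule.sub_mem hy (M.toSubmodule.smul_mem _ hxM), ?_⟩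
      (Submodule.smul_mem _ _ hx)
    rw [SetLike.mem_coe, LinearMap.mem_ker, map_sub, map_smul, smul_eq_mul,
      div_mul_cancel₀ _ hfx, sub_self])
  exact hfx (this hxM).2

theorem isStableUnder_map_frattiniIdeal (M : NonUnitalSubalgebra K A) :
    IsStableUnder (M : Set A) ((frattiniIdeal K M).map M.toSubmodule.subtype) := by
  rintro m hm _ ⟨z, hz, rfl⟩
  have h := (isGreatest_frattiniIdeal K M).1.1 ⟨m, hm⟩ z hz
  exact ⟨⟨_, h.1, rfl⟩, ⟨_, h.2, rfl⟩⟩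

variable [IsLeibniz A]

/-- A nonzero `J ≤ Φ(M)` cannot have an `M`-stable complement `P` in `N` if some left
multiplication by `m ∈ M` is injective on `J`. Otherwise `x ↦ m * x` followed by the projection
to `N / P ≃ J` would be bijective on `J`, so its kernel `D` would be a complement of `J` in `M`;
it is a subalgebra since left multiplication by `m` is a derivation. -/
theorem exists_mul_eq_zero_of_le_frattiniIdeal [FiniteDimensional K A]
    {N : Submodule K A} (hA : ∀ a b : A, a * b ∈ N) {M : NonUnitalSubalgebra K A}
    {J P : Submodule K A} (hJ : IsStableUnder (M : Set A) J) (hJ0 : J ≠ ⊥)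
    (hJΦ : J ≤ (frattiniIdeal K M).map M.toSubmodule.subtype)
    (hP : IsStableUnder (M : Set A) P) (hJP : J ⊓ P = ⊥) (hsup : J ⊔ P = N) {m : A} (hm : m ∈ M) :
    ∃ x ∈ J, x ≠ 0 ∧ m * x = 0 := by
  by_contra! hinj
  have hJM : J ≤ M.toSubmodule := hJΦ.trans (Submodule.map_subtype_le _ _)
  let D : NonUnitalSubalgebra K A :=
    { M.toSubmodule ⊓ P.comap (LinearMap.mulLeft K m) with
      mul_mem' := fun {a b} ha hb => by
        refine ⟨M.mul_mem ha.1 hb.1, ?_⟩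
        change m * (a * b) ∈ P
        rw [IsLeibniz.leibniz]
        exact P.add_mem (hP b hb.1 _ ha.2).2 (hP a ha.1 _ hb.2).1 }
  let g : Module.End K J := (LinearMap.mulLeft K m).restrict fun x hx => (hJ m hm x hx).1
  have hg : Function.Injective g := by
    rw [← LinearMap.ker_eq_bot, LinearMap.ker_eq_bot']
    rintro ⟨x, hx⟩ h
    by_contra hx0
    exact hinj x hx (fun h' => hx0 (Subtype.ext h')) (congrArg Subtype.val h)
  have hMD : M ≤ D := le_of_le_sup_map_frattiniIdeal (fun y hy => hy.1) (by
    intro x hx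
    obtain ⟨j, hj, p, hp, hjp⟩ := Submodule.mem_sup.1 (hsup ▸ hA m x : m * x ∈ J ⊔ P)
    obtain ⟨⟨i, hi⟩, hij⟩ := LinearMap.surjective_of_injective hg ⟨j, hj⟩
    have hij' : m * i = j := congrArg Subtype.val hij
    have hdec : x = (x - i) + i := by abel
    rw [hdec]
    refine Submodule.add_mem_sup ⟨M.toSubmodule.sub_mem hx (hJM hi), ?_⟩ (hJΦ hi)
    change m * (x - i) ∈ P
    rwa [mul_sub, hij', ← hjp, add_sub_cancel_left])
  obtain ⟨x, hx, hx0⟩ := Submodule.exists_mem_ne_zero_of_ne_bot hJ0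
  have : m * x ∈ J ⊓ P := ⟨(hJ m hm x hx).1, (hMD (hJM hx)).2⟩
  rw [hJP] at this
  exact hinj x hx hx0 this

/-- If `A² ≤ N` and `N² = 0`, then a minimal `S`-stable subspace `J` of `N` on which no left
multiplication by an element of `S` is injective is annihilated by `S` on both sides: kernels of
left multiplications on `J` are stable, hence all of `J`, and then `(x * a) * b = -(a * (x * b))`
vanishes on `J`. -/
theorem annihilated_of_not_injective {N : Submodule K A} (hNN : ∀ x ∈ N, ∀ y ∈ N, x * y = 0)
    (hA : ∀ a b : A, a * b ∈ N) {S : Set A} {J : Submodule K A} (hJN : J ≤ N)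
    (hJ : IsStableUnder S J)
    (hmin : ∀ I ≤ J, IsStableUnder S I → I ≠ ⊥ → I = J)
    (hker : ∀ m ∈ S, ∃ x ∈ J, x ≠ 0 ∧ m * x = 0) :
    ∀ m ∈ S, ∀ x ∈ J, m * x = 0 ∧ x * m = 0 := by
  have hleft : ∀ m ∈ S, ∀ x ∈ J, m * x = 0 := by
    intro m hm x hx
    have hst : IsStableUnder S (J ⊓ LinearMap.ker (LinearMap.mulLeft K m)) := by
      rintro a ha y ⟨hyJ, hy⟩
      have hy : m * y = 0 := hy
      refine ⟨⟨(hJ a ha y hyJ).1, ?_⟩, ⟨(hJ a ha y hyJ).2, ?_⟩⟩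
      · change m * (a * y) = 0
        rw [left_left_comm hNN hA m a (hJN hyJ), hy, mul_zero]
      · change m * (y * a) = 0
        rw [left_right_comm hNN hA m a (hJN hyJ), hy, zero_mul]
    obtain ⟨z, hz, hz0, hmz⟩ := hker m hm
    have heq := hmin _ inf_le_left hst
      ((Submodule.ne_bot_iff _).2 ⟨z, ⟨hz, hmz⟩, hz0⟩)
    exact (heq.ge hx).2
  have hrr : ∀ a ∈ S, ∀ b ∈ S, ∀ x ∈ J, (x * a) * b = 0 := by
    intro a ha b hb x hx
    rw [mul_mul_eq_neg hNN hA a b (hJN hx), hleft a ha _ (hJ b hb x hx).2, neg_zero]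
  -- The elements of `J` annihilated from the right form a stable subspace containing all `x * m`.
  let R : Submodule K A := J ⊓ ⨅ d ∈ S, LinearMap.ker (LinearMap.mulRight K d)
  have hR : ∀ x, x ∈ R ↔ x ∈ J ∧ ∀ d ∈ S, x * d = 0 := fun x => by simp [R]
  intro m hm x hx
  refine ⟨hleft m hm x hx, ?_⟩
  by_contra hxm
  have heq := hmin R inf_le_left (by
      intro a ha y hy
      rw [hR] at hy
      rw [hleft a ha y hy.1, hy.2 a ha]
      exact ⟨R.zero_mem, R.zero_mem⟩)
    ((Submodule.ne_bot_iff _).2 ⟨x * m, (hR _).2 ⟨(hJ m hm x hx).2,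
      fun d hd => hrr m hm d hd x hx⟩, hxm⟩)
  exact hxm (((hR x).1 (heq.ge hx)).2 m hm)

/-- A minimal `M`-stable subspace `J` of `Φ(M)` would be annihilated by `M`. As `N` and `C` are
abelian, the products of elements of `M` would then lie in a complement of `J` in `N`, although they
span a subspace containing `Φ(M)`. -/
theorem isElementary_of_split [FiniteDimensional K A] (hΦ : frattiniIdeal K A = ⊥)
    {N : Submodule K A} (hNN : ∀ x ∈ N, ∀ y ∈ N, x * y = 0) (hA : ∀ a b : A, a * b ∈ N)
    {C : NonUnitalSubalgebra K A} (hC : IsCompl N C.toSubmodule) : IsElementary K A := by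
  intro M
  by_contra hM
  set F := (frattiniIdeal K M).map M.toSubmodule.subtype with hF
  have hF0 : F ≠ ⊥ := fun h => hM
    (Submodule.map_injective_of_injective M.toSubmodule.injective_subtype
      (h.trans (Submodule.map_bot _).symm))
  obtain ⟨J, ⟨hJ0, hJF, hJ⟩, hmin⟩ := WellFounded.has_min
    (wellFounded_lt : WellFounded ((· < ·) : Submodule K A → _ → Prop))
    {J | J ≠ ⊥ ∧ J ≤ F ∧ IsStableUnder (M : Set A) J}
    ⟨F, hF0, le_rfl, isStableUnder_map_frattiniIdeal M⟩
  have hJN : J ≤ N := hJF.trans (map_frattiniIdeal_le M fun x _ y _ => hA x y)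
  obtain ⟨P, hP, hPN, hJP, hsup⟩ := exists_stable_compl hΦ hNN hA (M : Set A) hJN hJ
  have hann := annihilated_of_not_injective hNN hA hJN hJ
    (fun I hIJ hI hI0 => by
      by_contra hne
      exact hmin I ⟨hI0, hIJ.trans hJF, hI⟩ (lt_of_le_of_ne hIJ hne))
    (fun m hm => exists_mul_eq_zero_of_le_frattiniIdeal hA hJ hJ0 hJF hP hJP hsup hm)
  have hCC : ∀ c ∈ C, ∀ d ∈ C, c * d = 0 := fun c hc d hd =>
    Submodule.disjoint_def.1 hC.disjoint _ (hA c d) (C.mul_mem hc hd)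
  have hproj : ∀ n ∈ N, ∀ m ∈ M, n * m ∈ P ∧ m * n ∈ P := by
    intro n hn m hm
    rw [← hsup] at hn
    obtain ⟨j, hj, p, hp, rfl⟩ := Submodule.mem_sup.1 hn
    rw [add_mul, mul_add, (hann m hm j hj).1, (hann m hm j hj).2, zero_add, zero_add]
    exact ⟨(hP m hm p hp).2, (hP m hm p hp).1⟩
  -- Writing `x = n + c` and `y = n' + c'` along `A = N + C` gives `x * y = n * y + x * n'`.
  have hprod : ∀ x ∈ M, ∀ y ∈ M, x * y ∈ P := by
    intro x hx y hy
    obtain ⟨n, hn, c, hc, hnc⟩ := Submodule.mem_sup.1 (hC.sup_eq_top ▸ Submodule.mem_top : x ∈ _)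
    obtain ⟨n', hn', c', hc', hnc'⟩ :=
      Submodule.mem_sup.1 (hC.sup_eq_top ▸ Submodule.mem_top : y ∈ _)
    have : x * y = n * y + x * n' := by
      rw [← hnc, ← hnc']
      simp only [add_mul, mul_add, hNN n hn n' hn', hCC c hc c' hc']
      abel
    rw [this]
    exact P.add_mem (hproj n hn y hy).1 (hproj n' hn' x hx).2
  have hJP' : J ≤ J ⊓ P := le_inf le_rfl (hJF.trans (map_frattiniIdeal_le M hprod))
  rw [hJP, le_bot_iff] at hJP'
  exact hJ0 hJP'

end Subalgebras

end LeibnizFrattini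

theorem mainTheorem4 {K : Type*} {A : Type*} [Field K] [NonUnitalNonAssocRing A] [Module K A]
    [IsScalarTower K A A] [SMulCommClass K A A] [LeibnizFrattini.IsLeibniz A]
    [FiniteDimensional K A]
    (hΦ : LeibnizFrattini.frattiniIdeal K A = ⊥)
    (hnil : LeibnizFrattini.IsNilpotentAlgebra K (LeibnizFrattini.square K A)) :
    LeibnizFrattini.IsElementary K A := by
  have hA : ∀ a b : A, a * b ∈ (LeibnizFrattini.square K A).toSubmodule :=
    fun a b => Submodule.subset_span ⟨a, b, rfl⟩
  have hN : LeibnizFrattini.IsTwoSidedIdeal (LeibnizFrattini.square K A).toSubmodule :=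
    fun a x _ => ⟨hA a x, hA x a⟩
  have hNN := LeibnizFrattini.mul_eq_zero_of_nilpotent hΦ hN hnil
  obtain ⟨C, hC⟩ := LeibnizFrattini.exists_isCompl_of_abelian hΦ hN hNN
  exact LeibnizFrattini.isElementary_of_split hΦ hNN hA hC
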